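/- Let $p$ be a probability distribution of a pair $(X,Y)$ with $X\in\mathbb R^d$, $Y\in\{-1,+1\}$, whose label marginals are known, positive, and satisfy $p(Y=1)\neq p(Y=-1)$. Write $f_\theta(x)=\sum_{j=1}^d\theta_jx_j$, and let $L$ be one of the losses $$L_1(y,a)=e^{-ya},\qquad L_2(y,a)=\log(1+e^{-ya}),\qquad L_3(y,a)=\max(1-ya,0).$$ The risk is $R(\theta)=\mathbb E_p\,L(Y,f_\theta(X))$. Let $X^{(1)},X^{(2)},\dots$ be i.i.d. unlabeled observations with the $X$-marginal of $p$. Fix any $\theta\in\mathbb R^d$ for which $f_\theta(X)\,|\,\{Y=y\}\sim N(\mu_y,\sigma_y^2)$ for $y=\pm1$. Let $E$ be a closed set of parameters $(\mu,\sigma)=(\mu_1,\mu_{-1},\sigma_1,\sigma_{-1})$ which contains the true parameters and on which both $\sigma_1$ and $\sigma_{-1}$ are at least some constant $c>0$ (for instance any compact subset of $\mathbb R^2\times(0,\infty)^2$ containing the true parameters, or all of $\mathbb R^2\times[c,\infty)^2$ if $\sigma_{\pm1}\ge c$ for the true parameters). With $N(\,\cdot\,;m,s^2)$ the normal density, let $$\ell_n(\mu,\sigma)=\sum_{i=1}^n\log\sum_{y\in\{-1,+1\}}p(y)\,N\big(f_\theta(X^{(i)});\mu_y,\sigma_y^2\big),\qquad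 (\hat\mu^{(n)},\hat\sigma^{(n)})\in\operatorname*{argmax}_{(\mu,\sigma)\in E}\ell_n(\mu,\sigma),$$ $$\hat R_n(\theta)=\sum_{y\in\{-1,+1\}}p(y)\int_{\mathbb R}N\big(\alpha;\hat\mu^{(n)}_y,(\hat\sigma^{(n)}_y)^2\big)\,L(y,\alpha)\,d\alpha .$$ Then the loss $L(Y,f_\theta(X))$ is integrable, and so are the integrands $N(\alpha;\mu_y,\sigma_y^2)L(y,\alpha)$ for all $(\mu,\sigma)\in E$ and $y=\pm1$; almost surely the argmax is non-empty for all sufficiently large $n$; and for every choice of $(\hat\mu^{(n)},\hat\sigma^{(n)})$ that almost surely lies in the argmax for all sufficiently large $n$, $$P\Big(\lim_{n\to\infty}\hat R_n(\theta)=R(\theta)\Big)=1 .$$ -/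

import Mathlib

open MeasureTheory ProbabilityTheory Filter Topology

noncomputable section

namespace UnsupRisk

/-- Every set of labels is measurable (the labels `{-1, +1}` are the units `ℤˣ`). -/
instance : MeasurableSingletonClass ℤˣ where
  measurableSet_singleton y :=
    ⟨{(y : ℤ)}, measurableSet_singleton _, by ext z; simp [Units.ext_iff]⟩

/-- The linear score `f_θ(x) = ∑ j, θ_j x_j`. -/
def score {d : ℕ} (θ x : Fin d → ℝ) : ℝ := ∑ j, θ j * x j

/-- Exponential loss. Labels `y ∈ {-1, +1}` are the units `ℤˣ` of the integers. -/
def expLoss (y : ℤˣ) (a : ℝ) : ℝ := Real.exp (-(((y : ℤ) : ℝ) * a))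

/-- Logarithmic (logistic) loss. -/
def logLoss (y : ℤˣ) (a : ℝ) : ℝ := Real.log (1 + Real.exp (-(((y : ℤ) : ℝ) * a)))

/-- Hinge loss. -/
def hingeLoss (y : ℤˣ) (a : ℝ) : ℝ := max (1 - ((y : ℤ) : ℝ) * a) 0

/-- The event `{Y = y}` in the space of pairs (features, label). -/
def labelEvent (d : ℕ) (y : ℤˣ) : Set ((Fin d → ℝ) × ℤˣ) := {z | z.2 = y}

/-- The label marginal `p(Y = y)`. -/
def labelProb {d : ℕ} (P : Measure ((Fin d → ℝ) × ℤˣ)) (y : ℤˣ) : ℝ :=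
  P.real (labelEvent d y)

/-- The risk `R(θ) = E L(Y, f_θ(X))`. -/
def risk {d : ℕ} (P : Measure ((Fin d → ℝ) × ℤˣ)) (L : ℤˣ → ℝ → ℝ) (θ : Fin d → ℝ) : ℝ :=
  ∫ z, L z.2 (score θ z.1) ∂P

/-- Parameters `(μ, σ)` of a two-component Gaussian mixture, indexed by the labels. -/
abbrev MixParam : Type := (ℤˣ → ℝ) × (ℤˣ → ℝ)

/-- Density at `a` of the normal law with mean `μ_y` and standard deviation `σ_y`. -/
def compDensity (η : MixParam) (y : ℤˣ) (a : ℝ) : ℝ :=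
  gaussianPDFReal (η.1 y) (Real.toNNReal (η.2 y ^ 2)) a

/-- Log-likelihood of the first `n` points of `z` in the mixture with weights `p`. -/
def logLik (p : ℤˣ → ℝ) (z : ℕ → ℝ) (n : ℕ) (η : MixParam) : ℝ :=
  ∑ i ∈ Finset.range n, Real.log (∑ y : ℤˣ, p y * compDensity η y (z i))

/-- `η` is a maximum likelihood estimate, over the parameter set `E`, from the first `n`
points of `z`: a global maximizer of the log-likelihood on `E`. -/
def IsMLE (p : ℤˣ → ℝ) (E : Set MixParam) (z : ℕ → ℝ) (n : ℕ) (η : MixParam) : Prop :=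
  η ∈ E ∧ ∀ η' ∈ E, logLik p z n η' ≤ logLik p z n η

/-- The risk computed from weights `p` and normal conditional laws with parameters `η`. -/
def plugInRisk (p : ℤˣ → ℝ) (L : ℤˣ → ℝ → ℝ) (η : MixParam) : ℝ :=
  ∑ y : ℤˣ, p y * ∫ a, compDensity η y a * L y a

end UnsupRisk

end

/-!
The theorem is the strong consistency of the maximum likelihood estimator of a two-component normal
mixture with known weights, combined with the continuity of the plug-in risk.

Write `f_η` for the mixture density with parameters `η` and `f₀` for the true one, which is the
density of the score by the law of total probability (`integrable_and_integral_score`). Since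
`log t ≤ 2 (√t - 1)`, a parameter can beat the true one in likelihood only if the average of
`√(f_η / f₀)` over the sample is at least `1` (`logLik_lt_of_sum_sqrtRatio_lt`). Its expectation is
the Hellinger affinity `∫ √(f_η f₀)`, which is less than `1` unless `f_η = f₀`
(`integral_sqrt_mul_lt_one`).

The parameter set need not be compact, so each component gets a point at infinity, where its density
is `0`. As the standard deviations are bounded below, the extended density is continuous
(`continuous_extDensity`), and the affinity bound still applies: a mixture that has lost a component
has total mass less than `1`. Genuine mixtures are told apart by the linear independence of normal
densities and the inequality of the two weights (`mixture_identifiable`).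

Over the compactified parameter space, `√(f_η / f₀)` at a sample point is a random element of the
Banach space of continuous functions, with integrable norm. The strong law of large numbers in this
space makes the averages converge uniformly in the parameter (`ae_tendsto_average_sqrtRatio`). Hence
almost surely, off any neighbourhood of the true parameters, every likelihood is eventually smaller
than the true one (`eventually_logLik_lt`). This yields a maximizer, by compactness of a closed ball
(`exists_isMLE`), and forces every maximizer to converge to the true parameters. The plug-in risk is
continuous there (`tendsto_plugInRisk`) and its value is the risk.
-/

open MeasureTheory ProbabilityTheory Filter Topology

noncomputable section

namespace UnsupRisk

/-! ### Normal densities as functions of their parameters -/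

/-- The parameters `(m, s)` of a single normal component, `s` being the standard deviation, which
is bounded below by `c`. -/
abbrev Component (c : ℝ) : Type := {x : ℝ × ℝ // c ≤ x.2}

/-- The density of the normal law with mean `x.1` and standard deviation `x.2`. -/
def normalDensity (x : ℝ × ℝ) (a : ℝ) : ℝ :=
  gaussianPDFReal x.1 (Real.toNNReal (x.2 ^ 2)) a

lemma toNNReal_sq_ne_zero {s : ℝ} (hs : 0 < s) : Real.toNNReal (s ^ 2) ≠ 0 := by
  simpa using hs.ne'

lemma normalDensity_eq {x : ℝ × ℝ} (hx : 0 < x.2) (a : ℝ) :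
    normalDensity x a =
      (√(2 * Real.pi) * x.2)⁻¹ * Real.exp (-((a - x.1) / x.2) ^ 2 / 2) := by
  unfold normalDensity gaussianPDFReal
  rw [Real.coe_toNNReal _ (sq_nonneg _), Real.sqrt_mul (by positivity), Real.sqrt_sq hx.le]
  congr 2
  field_simp

lemma normalDensity_pos {x : ℝ × ℝ} (hx : 0 < x.2) (a : ℝ) : 0 < normalDensity x a :=
  gaussianPDFReal_pos _ _ _ (toNNReal_sq_ne_zero hx)

lemma normalDensity_nonneg (x : ℝ × ℝ) (a : ℝ) : 0 ≤ normalDensity x a :=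
  gaussianPDFReal_nonneg _ _ _

lemma normalDensity_mul_sd_le {x : ℝ × ℝ} (hx : 0 < x.2) (a : ℝ) :
    normalDensity x a * x.2 ≤ 1 := by
  rw [normalDensity_eq hx, mul_inv, mul_right_comm, inv_mul_cancel_right₀ hx.ne']
  refine mul_le_one₀ (inv_le_one_of_one_le₀ ?_) (Real.exp_nonneg _) ?_
  · rw [Real.one_le_sqrt]
    linarith [Real.pi_gt_three]
  · rw [Real.exp_le_one_iff]
    nlinarith [sq_nonneg ((a - x.1) / x.2)]

lemma normalDensity_mul_dist_le {x : ℝ × ℝ} (hx : 0 < x.2) (a : ℝ) :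
    normalDensity x a * |a - x.1| ≤ 1 := by
  set t := |a - x.1| / x.2 with ht
  have ht0 : 0 ≤ t := by positivity
  have hpi : 1 ≤ √(2 * Real.pi) := by
    rw [Real.one_le_sqrt]
    linarith [Real.pi_gt_three]
  have h : normalDensity x a * |a - x.1| = (√(2 * Real.pi))⁻¹ * (t * Real.exp (-t ^ 2 / 2)) := by
    rw [normalDensity_eq hx, ht, div_pow, div_pow, sq_abs]
    field_simp
  rw [h]
  refine mul_le_one₀ (inv_le_one_of_one_le₀ hpi) (by positivity) ?_
  rw [neg_div, Real.exp_neg, ← div_eq_mul_inv, div_le_one (Real.exp_pos _)]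
  nlinarith [Real.add_one_le_exp (t ^ 2 / 2), sq_nonneg (t - 1)]

lemma continuous_normalDensity_component {c : ℝ} (hc : 0 < c) :
    Continuous fun q : Component c × ℝ => normalDensity q.1.1 q.2 := by
  have hpos : ∀ q : Component c × ℝ, 0 < q.1.1.2 := fun q => hc.trans_le q.1.2
  simp_rw [fun q : Component c × ℝ => normalDensity_eq (hpos q) q.2]
  have h2 : ∀ q : Component c × ℝ, √(2 * Real.pi) * q.1.1.2 ≠ 0 := fun q =>
    mul_ne_zero (by positivity) (hpos q).ne'
  refine Continuous.mul (Continuous.inv₀ (by fun_prop) h2) ?_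
  refine Real.continuous_exp.comp ?_
  refine Continuous.div_const ?_ _
  refine Continuous.neg (Continuous.pow (Continuous.div (by fun_prop) (by fun_prop)
    fun q => (hpos q).ne') 2)

lemma continuous_normalDensity {x : ℝ × ℝ} (hx : 0 < x.2) : Continuous (normalDensity x) :=
  (continuous_normalDensity_component hx).comp
    (Continuous.prodMk_right (⟨x, le_rfl⟩ : Component x.2))

/-- A normal density is negligible at `+∞` against one with a larger standard deviation, or with
the same standard deviation and a larger mean. -/
lemma tendsto_normalDensity_div_atTop {x y : ℝ × ℝ} (hx : 0 < x.2) (hy : 0 < y.2)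
    (h : x.2 < y.2 ∨ x.2 = y.2 ∧ x.1 < y.1) :
    Tendsto (fun a => normalDensity x a / normalDensity y a) atTop (𝓝 0) := by
  set A : ℝ := (1 / y.2 ^ 2 - 1 / x.2 ^ 2) / 2 with hA
  set B : ℝ := x.1 / x.2 ^ 2 - y.1 / y.2 ^ 2 with hB
  set C : ℝ := (y.1 ^ 2 / y.2 ^ 2 - x.1 ^ 2 / x.2 ^ 2) / 2 with hC
  have heq : ∀ a, normalDensity x a / normalDensity y a
      = y.2 / x.2 * Real.exp (a * (A * a + B) + C) := by
    intro a
    have he : a * (A * a + B) + C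
        = -((a - x.1) / x.2) ^ 2 / 2 - -((a - y.1) / y.2) ^ 2 / 2 := by
      rw [hA, hB, hC]
      field_simp
      ring
    rw [normalDensity_eq hx, normalDensity_eq hy, he, Real.exp_sub]
    field_simp
  simp_rw [heq]
  suffices hq : Tendsto (fun a : ℝ => a * (A * a + B)) atTop atBot by
    simpa using (Real.tendsto_exp_atBot.comp
      (tendsto_atBot_add_const_right _ C hq)).const_mul (y.2 / x.2)
  rcases h with h | ⟨h, h'⟩
  · have hA0 : A < 0 := by
      have : 1 / y.2 ^ 2 < 1 / x.2 ^ 2 := by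
        apply one_div_lt_one_div_of_lt (by positivity)
        gcongr
      rw [hA]
      linarith
    exact tendsto_id.atTop_mul_atBot₀
      (tendsto_atBot_add_const_right _ B (tendsto_id.const_mul_atTop_of_neg hA0))
  · have hA0 : A = 0 := by rw [hA, h]; ring
    have hB0 : B < 0 := by
      rw [hB, h, ← sub_div]
      exact div_neg_of_neg_of_pos (by linarith) (by positivity)
    simp only [hA0, zero_mul, zero_add]
    exact tendsto_id.atTop_mul_const_of_neg hB0

/-- Distinct normal densities are linearly independent: in a vanishing combination, the dominant
density at `+∞` must have coefficient zero. -/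
lemma linearIndependent_normalDensity {c : ℝ} (hc : 0 < c) :
    LinearIndependent ℝ fun x : Component c => normalDensity x.1 := by
  classical
  rw [linearIndependent_iff']
  intro s g hg
  by_contra! hne
  obtain ⟨i, hi, hgi⟩ := hne
  have hpos : ∀ x : Component c, 0 < x.1.2 := fun x => hc.trans_le x.2
  obtain ⟨m, hm, hmax⟩ := Finset.exists_max_image (s.filter (g · ≠ 0))
    (fun x => toLex (x.1.2, x.1.1)) ⟨i, by simp [hi, hgi]⟩
  rw [Finset.mem_filter] at hm
  have hlim : Tendsto (fun a => ∑ x ∈ s, g x * (normalDensity x.1 a / normalDensity m.1 a)) atTop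
      (𝓝 (∑ x ∈ s, if x = m then g m else 0)) := by
    refine tendsto_finsetSum _ fun x hx => ?_
    split_ifs with hxm
    · subst hxm
      simp [div_self (normalDensity_pos (hpos x) _).ne']
    · by_cases hgx : g x = 0
      · simp [hgx]
      · have hlt : toLex (x.1.2, x.1.1) < toLex (m.1.2, m.1.1) := by
          refine lt_of_le_of_ne (hmax x (by simp [hx, hgx])) fun h => hxm ?_
          have h := toLex.injective h
          rw [Prod.mk.injEq] at h
          exact Subtype.ext (Prod.ext h.2 h.1)
        rw [Prod.Lex.toLex_lt_toLex] at hlt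
        simpa using (tendsto_normalDensity_div_atTop (hpos x) (hpos m) hlt).const_mul (g x)
  have hzero : ∀ a, ∑ x ∈ s, g x * (normalDensity x.1 a / normalDensity m.1 a) = 0 := by
    intro a
    have := congrFun hg a
    simp only [Finset.sum_apply, Pi.smul_apply, smul_eq_mul, Pi.zero_apply] at this
    simp_rw [← mul_div_assoc, ← Finset.sum_div, this, zero_div]
  simp_rw [hzero] at hlim
  rw [Finset.sum_ite_eq' s m, if_pos hm.1] at hlim
  exact hm.2 (tendsto_nhds_unique hlim tendsto_const_nhds)

/-- A two-component normal mixture with known distinct positive weights determines the parameters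
of each component. Distinct weights are what rules out exchanging the two components. -/
lemma mixture_identifiable {c : ℝ} (hc : 0 < c) {p : ℤˣ → ℝ} (hp : ∀ y, 0 < p y)
    (hne : p 1 ≠ p (-1)) {x x' : ℤˣ → Component c}
    (h : ∀ a, ∑ y, p y * normalDensity (x y).1 a = ∑ y, p y * normalDensity (x' y).1 a) :
    x = x' := by
  classical
  have key : (∑ y, Finsupp.single (x y) (p y)) = ∑ y, Finsupp.single (x' y) (p y) := by
    apply linearIndependent_normalDensity hc
    ext a
    simpa [Finsupp.linearCombination_single] using h a
  have hev := fun z => DFunLike.congr_fun key z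
  simp only [UnitsInt.univ, Finset.sum_pair (show (1 : ℤˣ) ≠ -1 by decide), Finsupp.add_apply,
    Finsupp.single_apply] at hev
  have h1 := hp 1
  have h2 := hp (-1)
  have e1 := hev (x 1)
  have e2 := hev (x (-1))
  have e3 := hev (x' 1)
  have e4 := hev (x' (-1))
  clear hev key h
  have : x 1 = x' 1 ∧ x (-1) = x' (-1) := by
    generalize x 1 = a at *
    generalize x (-1) = b at *
    generalize x' 1 = a' at *
    generalize x' (-1) = b' at *
    generalize p 1 = r at *
    generalize p (-1) = t at *
    grind
  funext y
  rcases Int.units_eq_one_or y with rfl | rfl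
  exacts [this.1, this.2]

/-! ### The one-point compactification of the parameters of a component -/

/-- The normal density, extended by zero to the point at infinity of the one-point
compactification of the parameter space. -/
def extDensity {c : ℝ} (x : OnePoint (Component c)) (a : ℝ) : ℝ :=
  x.elim 0 fun x => normalDensity x.1 a

@[simp] lemma extDensity_coe {c : ℝ} (x : Component c) (a : ℝ) :
    extDensity (x : OnePoint (Component c)) a = normalDensity x.1 a := rfl

@[simp] lemma extDensity_infty {c : ℝ} (a : ℝ) :
    extDensity (OnePoint.infty : OnePoint (Component c)) a = 0 := rfl

lemma extDensity_nonneg {c : ℝ} (x : OnePoint (Component c)) (a : ℝ) : 0 ≤ extDensity x a := by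
  induction x using OnePoint.rec with
  | infty => simp
  | coe x => exact normalDensity_nonneg _ _

lemma extDensity_le {c : ℝ} (hc : 0 < c) (x : OnePoint (Component c)) (a : ℝ) :
    extDensity x a ≤ c⁻¹ := by
  induction x using OnePoint.rec with
  | infty => simpa using hc.le
  | coe x =>
    rw [extDensity_coe, ← one_div, le_div_iff₀ hc]
    exact (mul_le_mul_of_nonneg_left x.2 (normalDensity_nonneg _ _)).trans
      (normalDensity_mul_sd_le (hc.trans_le x.2) a)

/-- Extending by zero is continuous, jointly with the argument of the density: a component whose
parameters leave every compact set has `s → ∞` or `|m| → ∞`, hence a density vanishing locally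
uniformly, being at most `1 / s` and `1 / |a - m|`. -/
lemma continuous_extDensity {c : ℝ} (hc : 0 < c) :
    Continuous fun q : OnePoint (Component c) × ℝ => extDensity q.1 q.2 := by
  rw [continuous_iff_continuousAt]
  rintro ⟨x, a₀⟩
  induction x using OnePoint.rec with
  | infty =>
    have hK : ∀ R : ℝ, IsCompact {x : Component c | x.1.2 ≤ R ∧ |x.1.1 - a₀| ≤ R} := by
      intro R
      have hc' : Topology.IsClosedEmbedding (Subtype.val : Component c → ℝ × ℝ) :=
        (isClosed_le continuous_const continuous_snd).isClosedEmbedding_subtypeVal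
      have hbox := hc'.isCompact_preimage
        ((isCompact_Icc (a := a₀ - R) (b := a₀ + R)).prod (isCompact_Icc (a := c) (b := R)))
      refine hbox.of_isClosed_subset ?_ ?_
      · have h1 : IsClosed {x : Component c | x.1.2 ≤ R} :=
          isClosed_le (by fun_prop) continuous_const
        have h2 : IsClosed {x : Component c | |x.1.1 - a₀| ≤ R} :=
          isClosed_le (by fun_prop) continuous_const
        exact h1.inter h2
      · rintro x ⟨h1, h2⟩
        rw [abs_le] at h2
        exact ⟨⟨by linarith, by linarith⟩, x.2, h1⟩
    rw [ContinuousAt, extDensity_infty, Metric.tendsto_nhds]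
    intro ε hε
    set R : ℝ := 2 / ε + 1 with hR
    have hR0 : 0 < 2 / ε := by positivity
    have hU : ((↑) '' {x : Component c | x.1.2 ≤ R ∧ |x.1.1 - a₀| ≤ R} :
        Set (OnePoint (Component c)))ᶜ ∈ 𝓝 (OnePoint.infty : OnePoint (Component c)) := by
      refine IsOpen.mem_nhds (OnePoint.isOpen_compl_image_coe.2 ⟨(hK R).isClosed, hK R⟩) ?_
      simp
    filter_upwards [prod_mem_nhds hU (Metric.ball_mem_nhds a₀ one_pos)]
    rintro ⟨x, a⟩ ⟨hx, ha⟩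
    rw [Real.dist_eq, sub_zero, abs_of_nonneg (extDensity_nonneg _ _)]
    induction x using OnePoint.rec with
    | infty => simpa using hε
    | coe x =>
      have hxpos := hc.trans_le x.2
      have hd := normalDensity_nonneg x.1 a
      rw [extDensity_coe]
      -- one of the two quantities controlling the density exceeds `2 / ε`
      have hbig : ∃ M, 2 / ε < M ∧ normalDensity x.1 a * M ≤ 1 := by
        by_cases hs : x.1.2 ≤ R
        · have hm : R < |x.1.1 - a₀| := by
            by_contra! hm
            exact hx ⟨x, ⟨hs, hm⟩, rfl⟩
          refine ⟨|a - x.1.1|, ?_, normalDensity_mul_dist_le hxpos a⟩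
          have ha' : |a - a₀| < 1 := by simpa [Real.dist_eq] using ha
          have := abs_sub_le x.1.1 a a₀
          rw [abs_sub_comm x.1.1 a] at this
          linarith
        · exact ⟨x.1.2, by linarith, normalDensity_mul_sd_le hxpos a⟩
      obtain ⟨M, hM, hle⟩ := hbig
      have h1 : normalDensity x.1 a * (2 / ε) ≤ 1 :=
        (mul_le_mul_of_nonneg_left hM.le hd).trans hle
      rw [mul_div_assoc', div_le_one hε] at h1
      linarith
  | coe x =>
    have he := (OnePoint.isOpenEmbedding_coe (X := Component c)).prodMap
      (Topology.IsOpenEmbedding.id (X := ℝ))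
    exact (he.continuousAt_iff (x := (x, a₀))
      (g := fun q : OnePoint (Component c) × ℝ => extDensity q.1 q.2)).1
      (continuous_normalDensity_component hc).continuousAt

/-! ### Losses and the plug-in risk -/

/-- The three losses enter the argument only through continuity and the exponential loss as a
common upper bound. -/
lemma loss_continuous_and_le {L : ℤˣ → ℝ → ℝ} (hL : L = expLoss ∨ L = logLoss ∨ L = hingeLoss)
    (y : ℤˣ) : Continuous (L y) ∧ ∀ a, |L y a| ≤ Real.exp (-(((y : ℤ) : ℝ) * a)) := by
  rcases hL with rfl | rfl | rfl
  · refine ⟨by unfold expLoss; fun_prop, fun a => ?_⟩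
    rw [expLoss, abs_of_pos (Real.exp_pos _)]
  · refine ⟨?_, fun a => ?_⟩
    · unfold logLoss
      exact Continuous.log (by fun_prop) fun a => by positivity
    · have h := Real.exp_pos (-(((y : ℤ) : ℝ) * a))
      rw [logLoss, abs_of_nonneg (Real.log_nonneg (by linarith))]
      linarith [Real.log_le_sub_one_of_pos (show 0 < 1 + Real.exp (-(((y : ℤ) : ℝ) * a)) by
        linarith)]
  · refine ⟨by unfold hingeLoss; fun_prop, fun a => ?_⟩
    rw [hingeLoss, abs_of_nonneg (le_max_right _ _)]
    refine max_le ?_ (Real.exp_nonneg _)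
    linarith [Real.add_one_le_exp (-(((y : ℤ) : ℝ) * a))]

lemma integrable_loss_gaussianReal {L : ℤˣ → ℝ → ℝ}
    (hL : L = expLoss ∨ L = logLoss ∨ L = hingeLoss) (y : ℤˣ) (m : ℝ) (v : NNReal) :
    Integrable (L y) (gaussianReal m v) := by
  obtain ⟨hcont, hle⟩ := loss_continuous_and_le hL y
  refine (integrable_exp_mul_gaussianReal (-((y : ℤ) : ℝ))).mono' hcont.aestronglyMeasurable ?_
  exact ae_of_all _ fun a => by
    simpa only [neg_mul, Real.norm_eq_abs] using hle a

lemma integrable_gaussianReal_iff {m : ℝ} {v : NNReal} (hv : v ≠ 0) {f : ℝ → ℝ} :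
    Integrable f (gaussianReal m v) ↔ Integrable fun a => gaussianPDFReal m v a * f a := by
  rw [gaussianReal_of_var_ne_zero _ hv, integrable_withDensity_iff_integrable_smul'
    (measurable_gaussianPDF _ _) (ae_of_all _ fun _ => gaussianPDF_lt_top)]
  simp [toReal_gaussianPDF]

lemma integral_compDensity_mul {η : MixParam} {y : ℤˣ} (hη : 0 < η.2 y) (f : ℝ → ℝ) :
    ∫ a, compDensity η y a * f a =
      ∫ a, f a ∂gaussianReal (η.1 y) (Real.toNNReal (η.2 y ^ 2)) := by
  rw [integral_gaussianReal_eq_integral_smul (toNNReal_sq_ne_zero hη)]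
  rfl

lemma integral_gaussianReal_eq_standard {f : ℝ → ℝ} (hf : Continuous f) (m s : ℝ) :
    ∫ a, f a ∂gaussianReal m (Real.toNNReal (s ^ 2)) = ∫ t, f (m + s * t) ∂gaussianReal 0 1 := by
  have h : (gaussianReal 0 1).map (fun t => m + s * t) =
      gaussianReal m (Real.toNNReal (s ^ 2)) := by
    rw [show (fun t => m + s * t) = (fun t => m + t) ∘ fun t => s * t from rfl,
      ← Measure.map_map (by fun_prop) (by fun_prop), gaussianReal_map_const_mul,
      gaussianReal_map_const_add]
    congr 1
    · simp
    · ext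
      simp [sq_nonneg]
  rw [← h, integral_map (by fun_prop) hf.aestronglyMeasurable]

/-- The expected loss under a normal law depends continuously on the mean and the standard
deviation: after reduction to the standard normal law the integrands are locally dominated. -/
lemma continuous_integral_loss {L : ℤˣ → ℝ → ℝ}
    (hL : L = expLoss ∨ L = logLoss ∨ L = hingeLoss) (y : ℤˣ) :
    Continuous fun q : ℝ × ℝ => ∫ t, L y (q.1 + q.2 * t) ∂gaussianReal 0 1 := by
  obtain ⟨hcont, hle⟩ := loss_continuous_and_le hL y
  rw [continuous_iff_continuousAt]
  rintro ⟨m, s⟩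
  refine continuousAt_of_dominated
    (bound := fun t => Real.exp (|m| + 1) *
      (Real.exp ((|s| + 1) * t) + Real.exp (-(|s| + 1) * t))) ?_ ?_ ?_ ?_
  · exact Eventually.of_forall fun q => (hcont.comp (by fun_prop)).aestronglyMeasurable
  · filter_upwards [Metric.ball_mem_nhds (m, s) one_pos] with q hq
    refine ae_of_all _ fun t => ?_
    rw [Metric.mem_ball, Prod.dist_eq, max_lt_iff, Real.dist_eq, Real.dist_eq] at hq
    have h1 : |q.1| ≤ |m| + 1 := by
      have := abs_sub_abs_le_abs_sub q.1 m
      linarith [hq.1]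
    have h2 : |q.2| ≤ |s| + 1 := by
      have := abs_sub_abs_le_abs_sub q.2 s
      linarith [hq.2]
    have hy : |((y : ℤ) : ℝ)| = 1 := by
      rcases Int.units_eq_one_or y with rfl | rfl <;> simp
    have h3 : -(((y : ℤ) : ℝ) * (q.1 + q.2 * t)) ≤ |m| + 1 + (|s| + 1) * |t| := by
      refine (neg_le_abs _).trans ?_
      rw [abs_mul, hy, one_mul]
      refine (abs_add_le _ _).trans ?_
      rw [abs_mul]
      gcongr
    refine (hle _).trans ((Real.exp_le_exp.2 h3).trans ?_)
    rw [Real.exp_add]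
    gcongr
    rcases abs_cases t with ⟨ht, -⟩ | ⟨ht, -⟩ <;> rw [ht]
    · exact le_add_of_nonneg_right (Real.exp_nonneg _)
    · rw [mul_neg, ← neg_mul]
      exact le_add_of_nonneg_left (Real.exp_nonneg _)
  · exact ((integrable_exp_mul_gaussianReal _).add
      (integrable_exp_mul_gaussianReal _)).const_mul _
  · exact ae_of_all _ fun t => (hcont.comp (by fun_prop)).continuousAt

/-- The plug-in risk is continuous along parameters with positive standard deviations. -/
lemma tendsto_plugInRisk {L : ℤˣ → ℝ → ℝ} (hL : L = expLoss ∨ L = logLoss ∨ L = hingeLoss)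
    {ι : Type*} {l : Filter ι} {η : ι → MixParam} {η₀ : MixParam} (p : ℤˣ → ℝ)
    (hη : Tendsto η l (𝓝 η₀)) (hpos : ∀ᶠ i in l, ∀ y, 0 < (η i).2 y) (hpos₀ : ∀ y, 0 < η₀.2 y) :
    Tendsto (fun i => plugInRisk p L (η i)) l (𝓝 (plugInRisk p L η₀)) := by
  have heq : ∀ η : MixParam, (∀ y, 0 < η.2 y) →
      plugInRisk p L η = ∑ y, p y * ∫ t, L y (η.1 y + η.2 y * t) ∂gaussianReal 0 1 := by
    intro η h
    refine Finset.sum_congr rfl fun y _ => ?_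
    rw [integral_compDensity_mul (h y),
      integral_gaussianReal_eq_standard (loss_continuous_and_le hL y).1]
  have hc : Continuous fun η : MixParam =>
      ∑ y, p y * ∫ t, L y (η.1 y + η.2 y * t) ∂gaussianReal 0 1 := by
    refine continuous_finsetSum _ fun y _ => continuous_const.mul ?_
    exact (continuous_integral_loss hL y).comp
      (by fun_prop : Continuous fun η : MixParam => (η.1 y, η.2 y))
  rw [heq η₀ hpos₀]
  refine ((hc.tendsto η₀).comp hη).congr' ?_
  filter_upwards [hpos] with i hi
  exact (heq _ hi).symm

/-! ### Integration against the law of the labelled score -/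

section Law

variable {d : ℕ} {P : Measure ((Fin d → ℝ) × ℤˣ)} [IsProbabilityMeasure P] {θ : Fin d → ℝ}
  {η₀ : MixParam}

lemma measurableSet_labelEvent (y : ℤˣ) : MeasurableSet (labelEvent d y) :=
  measurable_snd (measurableSet_singleton y)

lemma sum_labelProb (P : Measure ((Fin d → ℝ) × ℤˣ)) [IsProbabilityMeasure P] :
    ∑ y, labelProb P y = 1 := by
  have h := sum_measureReal_preimage_singleton (μ := P) (f := Prod.snd) (Finset.univ : Finset ℤˣ)
    (fun y _ => measurableSet_labelEvent (d := d) y)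
  rw [Finset.coe_univ, Set.preimage_univ, probReal_univ] at h
  exact h

lemma continuous_score (θ : Fin d → ℝ) : Continuous (score θ) := by
  unfold score
  fun_prop

/-- The law of total probability over the label, for functions of the label and the score. -/
lemma integrable_and_integral_score
    (hnormal : ∀ y : ℤˣ, (cond P (labelEvent d y)).map (fun z => score θ z.1) =
      gaussianReal (η₀.1 y) (Real.toNNReal (η₀.2 y ^ 2)))
    {h : ℤˣ → ℝ → ℝ} (hcont : ∀ y, Continuous (h y))
    (hint : ∀ y, Integrable (h y) (gaussianReal (η₀.1 y) (Real.toNNReal (η₀.2 y ^ 2)))) :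
    Integrable (fun z => h z.2 (score θ z.1)) P ∧
      ∫ z, h z.2 (score θ z.1) ∂P =
        ∑ y, labelProb P y *
          ∫ a, h y a ∂gaussianReal (η₀.1 y) (Real.toNNReal (η₀.2 y ^ 2)) := by
  have hscore : Measurable fun z : (Fin d → ℝ) × ℤˣ => score θ z.1 :=
    (continuous_score θ).measurable.comp measurable_fst
  have hP : P = ∑ y, P (labelEvent d y) • cond P (labelEvent d y) :=
    (sum_meas_smul_cond_fiber (X := Prod.snd) measurable_snd P).symm
  have hae : ∀ y, (fun z => h y (score θ z.1)) =ᵐ[cond P (labelEvent d y)]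
      fun z => h z.2 (score θ z.1) := by
    intro y
    filter_upwards [ae_cond_mem (μ := P) (measurableSet_labelEvent (d := d) y)] with z hz
    rw [show z.2 = y from hz]
  have hcond : ∀ y, Integrable (fun z => h z.2 (score θ z.1)) (cond P (labelEvent d y)) := by
    intro y
    refine Integrable.congr ?_ (hae y)
    have := hint y
    rw [← hnormal y] at this
    exact this.comp_measurable hscore
  have hsmul : ∀ y ∈ Finset.univ, Integrable (fun z => h z.2 (score θ z.1))
      (P (labelEvent d y) • cond P (labelEvent d y)) :=
    fun y _ => (hcond y).smul_measure (measure_ne_top _ _)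
  constructor
  · rw [hP]
    exact integrable_finsetSum_measure.2 hsmul
  · conv_lhs => rw [hP]
    rw [integral_finsetSum_measure hsmul]
    refine Finset.sum_congr rfl fun y _ => ?_
    rw [integral_smul_measure, ← integral_congr_ae (hae y), ← hnormal y,
      integral_map hscore.aemeasurable (hcont y).aestronglyMeasurable]
    rfl

end Law

/-! ### Hellinger affinity of mixtures -/

/-- The Hellinger affinity of two distinct continuous sub-probability densities is less than `1`,
since `√(u v) = (u + v) / 2 - (√u - √v)² / 2`. -/
lemma integral_sqrt_mul_lt_one {u v : ℝ → ℝ} (hu : Continuous u) (hv : Continuous v)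
    (hu0 : ∀ a, 0 ≤ u a) (hv0 : ∀ a, 0 ≤ v a) (hui : Integrable u) (hvi : Integrable v)
    (hu1 : ∫ a, u a ≤ 1) (hv1 : ∫ a, v a ≤ 1) (hne : u ≠ v) :
    ∫ a, √(u a * v a) < 1 := by
  have hexp : ∀ a, (√(u a) - √(v a)) ^ 2 / 2 = (u a + v a) / 2 - √(u a * v a) := by
    intro a
    rw [Real.sqrt_mul (hu0 a), sub_sq, Real.sq_sqrt (hu0 a), Real.sq_sqrt (hv0 a)]
    ring
  have hsum : Integrable fun a => (u a + v a) / 2 := (hui.add hvi).div_const 2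
  have hsqrt : Integrable fun a => √(u a * v a) := by
    refine hsum.mono' (by fun_prop) (ae_of_all _ fun a => ?_)
    rw [Real.norm_of_nonneg (Real.sqrt_nonneg _)]
    linarith [hexp a, sq_nonneg (√(u a) - √(v a))]
  by_contra! hge
  have hD : ∫ a, (√(u a) - √(v a)) ^ 2 / 2 ≤ 0 := by
    simp_rw [hexp]
    rw [integral_sub hsum hsqrt, integral_div, integral_add hui hvi]
    linarith
  have hDi : Integrable fun a => (√(u a) - √(v a)) ^ 2 / 2 := by
    simp_rw [hexp]
    exact hsum.sub hsqrt
  have hD0 := (integral_eq_zero_iff_of_nonneg (fun a => by positivity) hDi).1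
    (le_antisymm hD (integral_nonneg fun a => by positivity))
  have hall := (Continuous.ae_eq_iff_eq volume (by fun_prop) continuous_zero).1 hD0
  refine hne (funext fun a => ?_)
  have h := congrFun hall a
  simp only [Pi.zero_apply, div_eq_zero_iff, OfNat.ofNat_ne_zero, or_false, ne_eq,
    not_false_eq_true, pow_eq_zero_iff, sub_eq_zero] at h
  rwa [Real.sqrt_inj (hu0 a) (hv0 a)] at h

/-- Points of the compactified parameter space of the mixture; a component at infinity has lost
its mass. -/
abbrev ExtParam (c : ℝ) : Type := ℤˣ → OnePoint (Component c)

/-- The mixture density with weights `p`, extended to the compactified parameter space. -/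
def extMixture {c : ℝ} (p : ℤˣ → ℝ) (x : ExtParam c) (a : ℝ) : ℝ :=
  ∑ y, p y * extDensity (x y) a

section Mixture

variable {c : ℝ} {p : ℤˣ → ℝ}

lemma continuous_extMixture (hc : 0 < c) (p : ℤˣ → ℝ) :
    Continuous fun q : ExtParam c × ℝ => extMixture p q.1 q.2 := by
  refine continuous_finsetSum _ fun y _ => continuous_const.mul ?_
  exact (continuous_extDensity hc).comp
    (by fun_prop : Continuous fun q : ExtParam c × ℝ => (q.1 y, q.2))

lemma continuous_extMixture_right (hc : 0 < c) (p : ℤˣ → ℝ) (x : ExtParam c) :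
    Continuous (extMixture p x) :=
  (continuous_extMixture hc p).comp (Continuous.prodMk_right x)

lemma extMixture_nonneg (hp : ∀ y, 0 < p y) (x : ExtParam c) (a : ℝ) : 0 ≤ extMixture p x a :=
  Finset.sum_nonneg fun y _ => mul_nonneg (hp y).le (extDensity_nonneg _ _)

lemma extMixture_le (hc : 0 < c) (hp : ∀ y, 0 < p y) (hp1 : ∑ y, p y = 1) (x : ExtParam c)
    (a : ℝ) : extMixture p x a ≤ c⁻¹ := by
  calc extMixture p x a ≤ ∑ y, p y * c⁻¹ :=
        Finset.sum_le_sum fun y _ => mul_le_mul_of_nonneg_left (extDensity_le hc _ _) (hp y).le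
    _ = c⁻¹ := by rw [← Finset.sum_mul, hp1, one_mul]

lemma extMixture_coe_pos (hc : 0 < c) (hp : ∀ y, 0 < p y) (x : ℤˣ → Component c) (a : ℝ) :
    0 < extMixture p (fun y => (x y : OnePoint (Component c))) a :=
  Finset.sum_pos (fun y _ => mul_pos (hp y) (normalDensity_pos (hc.trans_le (x y).2) a))
    Finset.univ_nonempty

lemma integrable_extDensity (x : OnePoint (Component c)) : Integrable (extDensity x) := by
  induction x using OnePoint.rec with
  | infty => exact integrable_zero _ _ _
  | coe x => exact integrable_gaussianPDFReal _ _

lemma integral_extDensity_coe (hc : 0 < c) (x : Component c) :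
    ∫ a, extDensity (x : OnePoint (Component c)) a = 1 :=
  integral_gaussianPDFReal_eq_one _ (toNNReal_sq_ne_zero (hc.trans_le x.2))

lemma integral_extDensity_le (hc : 0 < c) (x : OnePoint (Component c)) :
    ∫ a, extDensity x a ≤ 1 := by
  induction x using OnePoint.rec with
  | infty => simp
  | coe x => exact (integral_extDensity_coe hc x).le

lemma integrable_extMixture (p : ℤˣ → ℝ) (x : ExtParam c) : Integrable (extMixture p x) :=
  integrable_finsetSum _ fun y _ => (integrable_extDensity (x y)).const_mul (p y)

lemma integral_extMixture (p : ℤˣ → ℝ) (x : ExtParam c) :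
    ∫ a, extMixture p x a = ∑ y, p y * ∫ a, extDensity (x y) a := by
  unfold extMixture
  rw [integral_finsetSum _ fun y _ => (integrable_extDensity (x y)).const_mul (p y)]
  simp_rw [integral_const_mul]

lemma integral_extMixture_le (hc : 0 < c) (hp : ∀ y, 0 < p y) (hp1 : ∑ y, p y = 1)
    (x : ExtParam c) : ∫ a, extMixture p x a ≤ 1 := by
  rw [integral_extMixture, ← hp1]
  exact Finset.sum_le_sum fun y _ =>
    mul_le_of_le_one_right (hp y).le (integral_extDensity_le hc (x y))

/-- Identifiability over the compactified parameter space: a mixture that has lost a component is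
not a probability density, and two genuine mixtures are told apart by `mixture_identifiable`. -/
lemma extMixture_ne (hc : 0 < c) (hp : ∀ y, 0 < p y) (hp1 : ∑ y, p y = 1) (hne : p 1 ≠ p (-1))
    {x : ExtParam c} {x₀ : ℤˣ → Component c} (hx : x ≠ fun y => (x₀ y : OnePoint (Component c))) :
    extMixture p x ≠ extMixture p fun y => (x₀ y : OnePoint (Component c)) := by
  intro h
  have hcoe : ∀ y, ∃ z : Component c, (z : OnePoint (Component c)) = x y := by
    by_contra! hinf
    obtain ⟨y₁, hy₁⟩ := hinf
    have hy₁ : x y₁ = OnePoint.infty := by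
      by_contra hy
      obtain ⟨z, hz⟩ := OnePoint.ne_infty_iff_exists.1 hy
      exact hy₁ z hz
    have hlt : ∫ a, extMixture p x a < 1 := by
      rw [integral_extMixture, ← hp1]
      refine Finset.sum_lt_sum (fun y _ =>
        mul_le_of_le_one_right (hp y).le (integral_extDensity_le hc (x y)))
        ⟨y₁, Finset.mem_univ _, ?_⟩
      simpa [hy₁] using hp y₁
    rw [h, integral_extMixture] at hlt
    simp_rw [integral_extDensity_coe hc, mul_one, hp1] at hlt
    exact hlt.false
  choose x' hx' using hcoe
  obtain rfl : x = fun y => (x' y : OnePoint (Component c)) := funext fun y => (hx' y).symm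
  have := mixture_identifiable hc hp hne (x := x') (x' := x₀) fun a => congrFun h a
  exact hx (by rw [this])

end Mixture

/-! ### The strong law for square roots of likelihood ratios -/

/-- The parameters of the mixture whose component with label `y` has the parameters `x y`. -/
def toMixParam {c : ℝ} (x : ℤˣ → Component c) : MixParam :=
  (fun y => (x y).1.1, fun y => (x y).1.2)

/-- The inclusion of the parameters of genuine mixtures into the compactified space. -/
def toExtParam {c : ℝ} (x : ℤˣ → Component c) : ExtParam c :=
  fun y => (x y : OnePoint (Component c))

/-- The square root of the likelihood ratio at `a` against the mixture with parameters `x₀`, as a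
continuous function on the compactified parameter space. -/
def sqrtRatio {c : ℝ} (hc : 0 < c) (p : ℤˣ → ℝ) (x₀ : ℤˣ → Component c) (a : ℝ) :
    C(ExtParam c, ℝ) where
  toFun x := √(extMixture p x a / extMixture p (toExtParam x₀) a)
  continuous_toFun :=
    (((continuous_extMixture hc p).comp (Continuous.prodMk_left a)).div_const _).sqrt

section SqrtRatio

variable {c : ℝ} {p : ℤˣ → ℝ} {x₀ : ℤˣ → Component c}

lemma continuous_sqrtRatio (hc : 0 < c) (hp : ∀ y, 0 < p y) :
    Continuous (sqrtRatio hc p x₀) := by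
  refine ContinuousMap.continuous_of_continuous_uncurry _ ?_
  refine Continuous.sqrt (Continuous.div ?_ ?_ fun q => (extMixture_coe_pos hc hp x₀ q.1).ne')
  · exact (continuous_extMixture hc p).comp continuous_swap
  · exact (continuous_extMixture_right hc p _).comp continuous_fst

lemma norm_sqrtRatio_le (hc : 0 < c) (hp : ∀ y, 0 < p y) (hp1 : ∑ y, p y = 1) (a : ℝ) :
    ‖sqrtRatio hc p x₀ a‖ ≤ √(c⁻¹ / extMixture p (toExtParam x₀) a) := by
  refine (ContinuousMap.norm_le _ (Real.sqrt_nonneg _)).2 fun x => ?_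
  refine (Real.norm_of_nonneg (Real.sqrt_nonneg _)).trans_le (Real.sqrt_le_sqrt ?_)
  have := extMixture_coe_pos hc hp x₀ a
  exact div_le_div_of_nonneg_right (extMixture_le hc hp hp1 x a) this.le

lemma integrable_sqrt_normalDensity {x : ℝ × ℝ} (hx : 0 < x.2) :
    Integrable fun a => √(normalDensity x a) := by
  have heq : ∀ a, √(normalDensity x a) =
      √((√(2 * Real.pi) * x.2)⁻¹) * Real.exp (-(1 / (4 * x.2 ^ 2)) * (a - x.1) ^ 2) := by
    intro a
    rw [normalDensity_eq hx, Real.sqrt_mul (by positivity), ← Real.exp_half]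
    congr 2
    field_simp
    ring
  simp_rw [heq]
  exact ((integrable_exp_neg_mul_sq (by positivity)).comp_sub_right x.1).const_mul _

/-- The envelope of `sqrtRatio` is integrable: multiplied by the true density it is a multiple
of the square root of a normal density. -/
lemma integrable_envelope (hc : 0 < c) (hp : ∀ y, 0 < p y) (y : ℤˣ) :
    Integrable (fun a => √(c⁻¹ / extMixture p (toExtParam x₀) a))
      (gaussianReal ((toMixParam x₀).1 y) (Real.toNNReal ((toMixParam x₀).2 y ^ 2))) := by
  have hy : 0 < (x₀ y).1.2 := hc.trans_le (x₀ y).2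
  have hf := continuous_extMixture_right hc p (toExtParam x₀)
  have hf0 := extMixture_coe_pos hc hp x₀
  have hN := continuous_normalDensity hy
  refine (integrable_gaussianReal_iff (toNNReal_sq_ne_zero hy)).2 ?_
  refine ((integrable_sqrt_normalDensity hy).const_mul √(c⁻¹ / p y)).mono' ?_
    (ae_of_all _ fun a => ?_)
  · exact (hN.mul (continuous_const.div hf fun a => (hf0 a).ne').sqrt).aestronglyMeasurable
  · change ‖normalDensity (x₀ y).1 a * _‖ ≤ _
    have hNa := normalDensity_pos hy a
    rw [Real.norm_of_nonneg (by positivity)]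
    have hle : p y * normalDensity (x₀ y).1 a ≤ extMixture p (toExtParam x₀) a :=
      Finset.single_le_sum (f := fun y => p y * normalDensity (x₀ y).1 a)
        (fun z _ => mul_nonneg (hp z).le (normalDensity_nonneg _ _)) (Finset.mem_univ y)
    have hpN := mul_pos (hp y) hNa
    calc normalDensity (x₀ y).1 a * √(c⁻¹ / extMixture p (toExtParam x₀) a)
        ≤ normalDensity (x₀ y).1 a * √(c⁻¹ / (p y * normalDensity (x₀ y).1 a)) := by gcongr
      _ = √(c⁻¹ / p y) * √(normalDensity (x₀ y).1 a) := by
        rw [← div_div, Real.sqrt_div (div_pos (inv_pos.2 hc) (hp y)).le, mul_div_left_comm,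
          Real.div_sqrt]

variable {d : ℕ} {P : Measure ((Fin d → ℝ) × ℤˣ)} [IsProbabilityMeasure P] {θ : Fin d → ℝ}

lemma integrable_sqrtRatio_score (hc : 0 < c) (hpos : ∀ y, 0 < labelProb P y)
    (hnormal : ∀ y : ℤˣ, (cond P (labelEvent d y)).map (fun z => score θ z.1) =
      gaussianReal ((toMixParam x₀).1 y) (Real.toNNReal ((toMixParam x₀).2 y ^ 2))) :
    Integrable (fun z => sqrtRatio hc (labelProb P) x₀ (score θ z.1)) P := by
  have hf := continuous_extMixture_right hc (labelProb P) (toExtParam x₀)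
  have hf0 := extMixture_coe_pos hc hpos x₀
  refine (integrable_and_integral_score hnormal
    (h := fun _ a => √(c⁻¹ / extMixture (labelProb P) (toExtParam x₀) a))
    (fun _ => (continuous_const.div hf fun a => (hf0 a).ne').sqrt)
    fun y => integrable_envelope hc hpos y).1.mono' ?_ (ae_of_all _ fun z =>
      norm_sqrtRatio_le hc hpos (sum_labelProb P) _)
  exact ((continuous_sqrtRatio hc hpos).stronglyMeasurable.comp_measurable
    ((continuous_score θ).measurable.comp measurable_fst)).aestronglyMeasurable

/-- The expected square root of the likelihood ratio is the Hellinger affinity with the true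
mixture, so it is less than `1` away from the true parameters. -/
lemma integral_sqrtRatio_lt_one (hc : 0 < c) (hpos : ∀ y, 0 < labelProb P y)
    (hne : labelProb P 1 ≠ labelProb P (-1))
    (hnormal : ∀ y : ℤˣ, (cond P (labelEvent d y)).map (fun z => score θ z.1) =
      gaussianReal ((toMixParam x₀).1 y) (Real.toNNReal ((toMixParam x₀).2 y ^ 2)))
    {x : ExtParam c} (hx : x ≠ toExtParam x₀) :
    (∫ z, sqrtRatio hc (labelProb P) x₀ (score θ z.1) ∂P) x < 1 := by
  set p := labelProb P with hp
  have hp1 : ∑ y, p y = 1 := sum_labelProb P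
  have hcont : Continuous fun a => sqrtRatio hc p x₀ a x :=
    (continuous_eval_const x).comp (continuous_sqrtRatio hc hpos)
  have hint : ∀ y, Integrable (fun a => sqrtRatio hc p x₀ a x)
      (gaussianReal ((toMixParam x₀).1 y) (Real.toNNReal ((toMixParam x₀).2 y ^ 2))) := fun y =>
    (integrable_envelope hc hpos y).mono' hcont.aestronglyMeasurable (ae_of_all _ fun a =>
      ((sqrtRatio hc p x₀ a).norm_coe_le_norm x).trans (norm_sqrtRatio_le hc hpos hp1 a))
  have hsd : ∀ y, 0 < (toMixParam x₀).2 y := fun y => hc.trans_le (x₀ y).2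
  rw [ContinuousMap.integral_apply (integrable_sqrtRatio_score hc hpos hnormal),
    (integrable_and_integral_score hnormal (h := fun _ a => sqrtRatio hc p x₀ a x)
      (fun _ => hcont) hint).2, ← hp]
  have hint' : ∀ y, Integrable fun a => compDensity (toMixParam x₀) y a * sqrtRatio hc p x₀ a x :=
    fun y => (integrable_gaussianReal_iff (toNNReal_sq_ne_zero (hsd y))).1 (hint y)
  simp_rw [← integral_compDensity_mul (hsd _), ← integral_const_mul]
  rw [← integral_finsetSum _ fun y _ => (hint' y).const_mul (p y)]
  have heq : ∀ a, ∑ y, p y * (compDensity (toMixParam x₀) y a * sqrtRatio hc p x₀ a x) =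
      √(extMixture p x a * extMixture p (toExtParam x₀) a) := by
    intro a
    simp_rw [← mul_assoc, ← Finset.sum_mul]
    change extMixture p (toExtParam x₀) a *
      √(extMixture p x a / extMixture p (toExtParam x₀) a) = _
    rw [Real.sqrt_div (extMixture_nonneg hpos x a), Real.sqrt_mul (extMixture_nonneg hpos x a),
      mul_div_left_comm, Real.div_sqrt]
  simp_rw [heq]
  exact integral_sqrt_mul_lt_one (continuous_extMixture_right hc p _)
    (continuous_extMixture_right hc p _) (extMixture_nonneg hpos _) (extMixture_nonneg hpos _)
    (integrable_extMixture p _) (integrable_extMixture p _) (integral_extMixture_le hc hpos hp1 _)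
    (integral_extMixture_le hc hpos hp1 _) (extMixture_ne hc hpos hp1 hne hx)

variable {Ω : Type*} [MeasurableSpace Ω] {Q : Measure Ω} {X : ℕ → Ω → (Fin d → ℝ)}

/-- The strong law of large numbers in the Banach space of continuous functions on the compactified
parameter space: it is a law of large numbers uniform in the parameters. -/
lemma ae_tendsto_average_sqrtRatio (hXm : ∀ i, Measurable (X i))
    (hXlaw : ∀ i, Q.map (X i) = P.map Prod.fst) (hXindep : iIndepFun X Q)
    (hc : 0 < c) (hpos : ∀ y, 0 < labelProb P y)
    (hnormal : ∀ y : ℤˣ, (cond P (labelEvent d y)).map (fun z => score θ z.1) =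
      gaussianReal ((toMixParam x₀).1 y) (Real.toNNReal ((toMixParam x₀).2 y ^ 2))) :
    ∀ᵐ ω ∂Q, Tendsto (fun n : ℕ => (n : ℝ)⁻¹ • ∑ i ∈ Finset.range n,
      sqrtRatio hc (labelProb P) x₀ (score θ (X i ω))) atTop
      (𝓝 (∫ z, sqrtRatio hc (labelProb P) x₀ (score θ z.1) ∂P)) := by
  borelize C(ExtParam c, ℝ)
  set Φ : (Fin d → ℝ) → C(ExtParam c, ℝ) := fun v => sqrtRatio hc (labelProb P) x₀ (score θ v)
  have hΦ : Continuous Φ := (continuous_sqrtRatio hc hpos).comp (continuous_score θ)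
  have hΦi : Integrable Φ (Q.map (X 0)) := by
    rw [hXlaw, integrable_map_measure hΦ.stronglyMeasurable.aestronglyMeasurable (by fun_prop)]
    exact integrable_sqrtRatio_score hc hpos hnormal
  have hmean : ∫ ω, Φ (X 0 ω) ∂Q = ∫ z, Φ z.1 ∂P := by
    rw [← integral_map (hXm 0).aemeasurable hΦ.stronglyMeasurable.aestronglyMeasurable, hXlaw,
      integral_map (by fun_prop) hΦ.stronglyMeasurable.aestronglyMeasurable]
  have h := strong_law_ae (μ := Q) (fun i ω => Φ (X i ω)) (hΦi.comp_measurable (hXm 0))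
    (fun i j hij => (hXindep.indepFun hij).comp hΦ.measurable hΦ.measurable)
    (fun i => IdentDistrib.comp ⟨(hXm i).aemeasurable, (hXm 0).aemeasurable,
      (hXlaw i).trans (hXlaw 0).symm⟩ hΦ.measurable)
  rw [hmean] at h
  exact h

end SqrtRatio

/-! ### Consistency of maximum likelihood -/

section Consistency

variable {c : ℝ} {p : ℤˣ → ℝ} {x₀ : ℤˣ → Component c} {z : ℕ → ℝ}

/-- Uniform convergence to a limit that is less than `1` off a point: off a neighbourhood of this
point the sums are eventually less than the number of terms. -/
lemma eventually_sum_lt_of_tendsto_average {K : Type*} [TopologicalSpace K] [CompactSpace K]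
    {g : ℕ → C(K, ℝ)} {G : C(K, ℝ)} {k₀ : K} (hG : ∀ k ≠ k₀, G k < 1)
    (h : Tendsto (fun n : ℕ => (n : ℝ)⁻¹ • ∑ i ∈ Finset.range n, g i) atTop (𝓝 G))
    {U : Set K} (hU : U ∈ 𝓝 k₀) :
    ∀ᶠ n : ℕ in atTop, ∀ k ∉ U, ∑ i ∈ Finset.range n, g i k < n := by
  have hK : IsCompact (interior U)ᶜ := isOpen_interior.isClosed_compl.isCompact
  rcases (interior U)ᶜ.eq_empty_or_nonempty with hemp | hnonempty
  · refine Eventually.of_forall fun n k hk => absurd ?_ hk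
    exact interior_subset (Set.compl_empty_iff.1 hemp ▸ Set.mem_univ k)
  obtain ⟨k₁, hk₁, hmax⟩ := hK.exists_isMaxOn hnonempty G.continuous.continuousOn
  have hlt : G k₁ < 1 := hG k₁ fun h => hk₁ (h ▸ mem_interior_iff_mem_nhds.2 hU)
  filter_upwards [Metric.tendsto_nhds.1 h (1 - G k₁) (by linarith), eventually_gt_atTop 0]
    with n hn hn0 k hk
  have hk' : G k ≤ G k₁ := hmax fun h => hk (interior_subset h)
  have hd := (ContinuousMap.dist_apply_le_dist k).trans_lt hn
  rw [Real.dist_eq] at hd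
  have hd := (le_abs_self _).trans_lt hd
  have hn0' : (0 : ℝ) < n := by exact_mod_cast hn0
  rw [ContinuousMap.smul_apply, ContinuousMap.sum_apply, smul_eq_mul] at hd
  have : (n : ℝ)⁻¹ * ∑ i ∈ Finset.range n, g i k < 1 := by linarith
  rwa [inv_mul_lt_iff₀ hn0', mul_one] at this

lemma logLik_toMixParam (p : ℤˣ → ℝ) (z : ℕ → ℝ) (n : ℕ) (x : ℤˣ → Component c) :
    logLik p z n (toMixParam x) =
      ∑ i ∈ Finset.range n, Real.log (extMixture p (toExtParam x) (z i)) := rfl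

/-- The inequality `log t ≤ 2 (√t - 1)` for each likelihood ratio. -/
lemma logLik_lt_of_sum_sqrtRatio_lt (hc : 0 < c) (hp : ∀ y, 0 < p y) {n : ℕ}
    {x : ℤˣ → Component c}
    (h : ∑ i ∈ Finset.range n, sqrtRatio hc p x₀ (z i) (toExtParam x) < n) :
    logLik p z n (toMixParam x) < logLik p z n (toMixParam x₀) := by
  rw [← sub_neg, logLik_toMixParam, logLik_toMixParam, ← Finset.sum_sub_distrib]
  have hle : ∀ i ∈ Finset.range n, Real.log (extMixture p (toExtParam x) (z i)) -
      Real.log (extMixture p (toExtParam x₀) (z i)) ≤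
        2 * (sqrtRatio hc p x₀ (z i) (toExtParam x) - 1) := by
    intro i _
    have h1 := extMixture_coe_pos hc hp x (z i)
    have h2 := extMixture_coe_pos hc hp x₀ (z i)
    have h3 := div_pos h1 h2
    have h4 := Real.log_le_sub_one_of_pos (Real.sqrt_pos.2 h3)
    rw [Real.log_sqrt h3.le, Real.log_div h1.ne' h2.ne'] at h4
    change _ ≤ 2 * (√_ - 1)
    unfold toExtParam
    linarith
  refine (Finset.sum_le_sum hle).trans_lt ?_
  rw [← Finset.mul_sum, Finset.sum_sub_distrib]
  simp only [Finset.sum_const, Finset.card_range, nsmul_eq_mul, mul_one]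
  linarith

lemma isClosedEmbedding_toMixParam :
    Topology.IsClosedEmbedding (toMixParam : (ℤˣ → Component c) → MixParam) := by
  -- truncating the standard deviations from below is a continuous retraction
  let r : MixParam → ℤˣ → Component c := fun η y => ⟨(η.1 y, max c (η.2 y)), le_max_left _ _⟩
  refine Function.LeftInverse.isClosedEmbedding (f := r) (fun x => ?_) ?_ ?_
  · funext y
    exact Subtype.ext (Prod.ext rfl (max_eq_right (x y).2))
  · exact continuous_pi fun y => Continuous.subtype_mk (by fun_prop) _
  · unfold toMixParam
    fun_prop

lemma continuous_logLik_toMixParam (hc : 0 < c) (hp : ∀ y, 0 < p y) (z : ℕ → ℝ) (n : ℕ) :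
    Continuous fun x : ℤˣ → Component c => logLik p z n (toMixParam x) := by
  refine continuous_finsetSum _ fun i _ =>
    Continuous.log ?_ fun x => (extMixture_coe_pos hc hp x (z i)).ne'
  refine continuous_finsetSum _ fun y _ => continuous_const.mul ?_
  exact (continuous_normalDensity_component hc).comp
    (by fun_prop : Continuous fun x : ℤˣ → Component c => (x y, z i))

/-- Off every neighbourhood of the true parameters, the likelihood is eventually smaller than at
the true parameters. -/
lemma eventually_logLik_lt (hc : 0 < c) (hp : ∀ y, 0 < p y) {E : Set MixParam}
    (hE : ∀ η ∈ E, ∀ y, c ≤ η.2 y) {G : C(ExtParam c, ℝ)} (hG : ∀ x ≠ toExtParam x₀, G x < 1)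
    (h : Tendsto (fun n : ℕ => (n : ℝ)⁻¹ • ∑ i ∈ Finset.range n, sqrtRatio hc p x₀ (z i)) atTop
      (𝓝 G)) {V : Set MixParam} (hV : V ∈ 𝓝 (toMixParam x₀)) :
    ∀ᶠ n in atTop, ∀ η ∈ E, η ∉ V → logLik p z n η < logLik p z n (toMixParam x₀) := by
  have hemb : Topology.IsOpenEmbedding (toExtParam : (ℤˣ → Component c) → ExtParam c) :=
    Topology.IsOpenEmbedding.piMap fun _ => OnePoint.isOpenEmbedding_coe
  have hU : toExtParam '' (toMixParam ⁻¹' V) ∈ 𝓝 (toExtParam x₀) :=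
    hemb.image_mem_nhds.2 (isClosedEmbedding_toMixParam.continuous.continuousAt hV)
  filter_upwards [eventually_sum_lt_of_tendsto_average hG h hU] with n hn η hη hηV
  obtain ⟨x, rfl⟩ : ∃ x : ℤˣ → Component c, toMixParam x = η :=
    ⟨fun y => ⟨(η.1 y, η.2 y), hE η hη y⟩, rfl⟩
  refine logLik_lt_of_sum_sqrtRatio_lt hc hp (hn _ ?_)
  rintro ⟨x', hx', he⟩
  exact hηV (hemb.injective he ▸ hx')

/-- If the likelihood is smaller off the unit ball than at its centre, it attains its maximum over
a closed set containing the centre. -/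
lemma exists_isMLE (hc : 0 < c) (hp : ∀ y, 0 < p y) {E : Set MixParam} (hEclosed : IsClosed E)
    (hE : ∀ η ∈ E, ∀ y, c ≤ η.2 y) {η₀ : MixParam} (hη₀ : η₀ ∈ E) {n : ℕ}
    (h : ∀ η ∈ E, η ∉ Metric.closedBall η₀ 1 → logLik p z n η < logLik p z n η₀) :
    ∃ η, IsMLE p E z n η := by
  have hlift : ∀ η ∈ E, ∃ x : ℤˣ → Component c, toMixParam x = η := fun η hη =>
    ⟨fun y => ⟨(η.1 y, η.2 y), hE η hη y⟩, rfl⟩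
  have hK : IsCompact ((toMixParam : (ℤˣ → Component c) → MixParam) ⁻¹'
      (E ∩ Metric.closedBall η₀ 1)) :=
    isClosedEmbedding_toMixParam.isCompact_preimage
      ((isCompact_closedBall η₀ 1).inter_left hEclosed)
  obtain ⟨x₀, rfl⟩ := hlift η₀ hη₀
  have hmem : x₀ ∈ (toMixParam : (ℤˣ → Component c) → MixParam) ⁻¹'
      (E ∩ Metric.closedBall (toMixParam x₀) 1) :=
    ⟨hη₀, Metric.mem_closedBall_self zero_le_one⟩
  obtain ⟨x, hx, hmax⟩ := hK.exists_isMaxOn ⟨x₀, hmem⟩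
    (continuous_logLik_toMixParam hc hp z n).continuousOn
  refine ⟨toMixParam x, hx.1, fun η hη => ?_⟩
  by_cases hηB : η ∈ Metric.closedBall (toMixParam x₀) 1
  · obtain ⟨x', rfl⟩ := hlift η hη
    exact hmax ⟨hη, hηB⟩
  · exact (h η hη hηB).le.trans (hmax hmem)

end Consistency

end UnsupRisk

end

theorem mainTheorem2 {d : ℕ}
    (P : Measure ((Fin d → ℝ) × ℤˣ)) [IsProbabilityMeasure P]
    (hpos : ∀ y : ℤˣ, 0 < UnsupRisk.labelProb P y)
    (hne : UnsupRisk.labelProb P 1 ≠ UnsupRisk.labelProb P (-1))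
    (L : ℤˣ → ℝ → ℝ)
    (hL : L = UnsupRisk.expLoss ∨ L = UnsupRisk.logLoss ∨ L = UnsupRisk.hingeLoss)
    {Ω : Type*} [MeasurableSpace Ω] (Q : Measure Ω) [IsProbabilityMeasure Q]
    (X : ℕ → Ω → (Fin d → ℝ)) (hXm : ∀ i, Measurable (X i))
    (hXlaw : ∀ i, Q.map (X i) = P.map Prod.fst) (hXindep : iIndepFun X Q)
    (θ : Fin d → ℝ) (η₀ : UnsupRisk.MixParam)
    (hnormal : ∀ y : ℤˣ,
      (cond P (UnsupRisk.labelEvent d y)).map (fun z => UnsupRisk.score θ z.1) =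
        gaussianReal (η₀.1 y) (Real.toNNReal (η₀.2 y ^ 2)))
    (E : Set UnsupRisk.MixParam) (hEclosed : IsClosed E) (c : ℝ) (hc : 0 < c)
    (hE : ∀ η ∈ E, ∀ y : ℤˣ, c ≤ η.2 y) (hη₀ : η₀ ∈ E) :
    Integrable (fun z => L z.2 (UnsupRisk.score θ z.1)) P ∧
    (∀ η ∈ E, ∀ y : ℤˣ, Integrable (fun a => UnsupRisk.compDensity η y a * L y a)) ∧
    (∀ᵐ ω ∂Q, ∀ᶠ n in atTop, ∃ η : UnsupRisk.MixParam,
      UnsupRisk.IsMLE (UnsupRisk.labelProb P) E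
        (fun i => UnsupRisk.score θ (X i ω)) n η) ∧
    ∀ ηhat : ℕ → Ω → UnsupRisk.MixParam,
      (∀ᵐ ω ∂Q, ∀ᶠ n in atTop,
        UnsupRisk.IsMLE (UnsupRisk.labelProb P) E
          (fun i => UnsupRisk.score θ (X i ω)) n (ηhat n ω)) →
      ∀ᵐ ω ∂Q, Tendsto
        (fun n => UnsupRisk.plugInRisk (UnsupRisk.labelProb P) L (ηhat n ω))
        atTop (𝓝 (UnsupRisk.risk P L θ)) := by
  open UnsupRisk in
  have hloss := integrable_and_integral_score (h := L) hnormal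
    (fun y => (loss_continuous_and_le hL y).1) fun y => integrable_loss_gaussianReal hL y _ _
  obtain ⟨x₀, rfl⟩ : ∃ x₀ : ℤˣ → Component c, toMixParam x₀ = η₀ :=
    ⟨fun y => ⟨(η₀.1 y, η₀.2 y), hE η₀ hη₀ y⟩, rfl⟩
  have hsd : ∀ η ∈ E, ∀ y, 0 < η.2 y := fun η hη y => hc.trans_le (hE η hη y)
  have hsep : ∀ᵐ ω ∂Q, ∀ V ∈ 𝓝 (toMixParam x₀), ∀ᶠ n in atTop, ∀ η ∈ E, η ∉ V →
      logLik (labelProb P) (fun i => score θ (X i ω)) n η <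
        logLik (labelProb P) (fun i => score θ (X i ω)) n (toMixParam x₀) := by
    filter_upwards [ae_tendsto_average_sqrtRatio hXm hXlaw hXindep hc hpos hnormal] with ω hω V hV
    exact eventually_logLik_lt hc hpos hE
      (fun x hx => integral_sqrtRatio_lt_one hc hpos hne hnormal hx) hω hV
  refine ⟨hloss.1, fun η hη y => ?_, ?_, fun ηhat hMLE => ?_⟩
  · exact (integrable_gaussianReal_iff (toNNReal_sq_ne_zero (hsd η hη y))).1
      (integrable_loss_gaussianReal hL y _ _)
  · filter_upwards [hsep] with ω hω
    filter_upwards [hω _ (Metric.closedBall_mem_nhds _ one_pos)] with n hn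
    exact exists_isMLE hc hpos hEclosed hE hη₀ hn
  · filter_upwards [hsep, hMLE] with ω hω hm
    have hrisk : risk P L θ = plugInRisk (labelProb P) L (toMixParam x₀) := by
      rw [risk, hloss.2]
      exact Finset.sum_congr rfl fun y _ => by rw [integral_compDensity_mul (hsd _ hη₀ y)]
    rw [hrisk]
    refine tendsto_plugInRisk hL _ ?_ (hm.mono fun n hn => hsd _ hn.1) (hsd _ hη₀)
    refine tendsto_def.2 fun V hV => ?_
    filter_upwards [hω V hV, hm] with n hn hmn
    by_contra hnV
    exact (hn _ hmn.1 hnV).not_ge (hmn.2 _ hη₀)
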